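/- Let $M$ be a connected regular matroid on a finite ground set. (A matroid is connected if any two distinct elements lie in a common circuit, and regular if it can be represented over $\mathbb{R}$ by a totally unimodular matrix.) Then the following two statements are equivalent. (a) $M$ has the symmetric strong circuit elimination property: whenever $C_1$ and $C_2$ are circuits of $M$ and $e_1, e_2, e$ are elements such that $e_1\in C_1 - C_2$, $e_2\in C_2 - C_1$ and $e\in C_1\cap C_2$, there is a circuit $C_3$ of $M$ with $\{e_1,e_2\}\subseteq C_3\subseteq (C_1\cup C_2)-\{e\}$. (b) $M$ is circuit-difference: for every two distinct circuits $C_1$ and $C_2$ of $M$ with $C_1\cap C_2\neq\emptyset$, the symmetric difference $C_1\mathbin{\Delta} C_2$ is a circuit of $M$. -/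

import Mathlib

namespace Matroid

/-- A matroid is connected if any two distinct elements of its ground set lie in a common
circuit. -/
def Connected {α : Type*} (M : Matroid α) : Prop :=
  ∀ e ∈ M.E, ∀ f ∈ M.E, e ≠ f → ∃ C, M.IsCircuit C ∧ e ∈ C ∧ f ∈ C

/-- A matroid is regular if it is represented over `ℝ` by a totally unimodular matrix, that is,
if it is the matroid of linear independence on the columns of such a matrix, whose columns are
labelled by the ground set. -/
def IsRegular {α : Type*} (M : Matroid α) : Prop :=
  ∃ (r : ℕ) (A : Matrix (Fin r) M.E ℝ), A.IsTotallyUnimodular ∧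
    ∀ I : Set M.E, M.Indep (Subtype.val '' I) ↔ LinearIndepOn ℝ A.col I

/-- The symmetric strong circuit elimination property. -/
def SymmetricStrongCircuitElimination {α : Type*} (M : Matroid α) : Prop :=
  ∀ C₁ C₂ : Set α, M.IsCircuit C₁ → M.IsCircuit C₂ →
    ∀ e₁ e₂ e : α, e₁ ∈ C₁ \ C₂ → e₂ ∈ C₂ \ C₁ → e ∈ C₁ ∩ C₂ →
      ∃ C₃ : Set α, M.IsCircuit C₃ ∧ {e₁, e₂} ⊆ C₃ ∧ C₃ ⊆ (C₁ ∪ C₂) \ {e}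

/-- A matroid is circuit-difference if the symmetric difference of any two distinct intersecting
circuits is a circuit. -/
def CircuitDifference {α : Type*} (M : Matroid α) : Prop :=
  ∀ C₁ C₂ : Set α, M.IsCircuit C₁ → M.IsCircuit C₂ → C₁ ≠ C₂ → (C₁ ∩ C₂).Nonempty →
    M.IsCircuit (symmDiff C₁ C₂)

end Matroid

open Matrix
open scoped symmDiff

/-! From (b) to (a), `C₁ ∆ C₂` itself is the circuit sought. For the converse, work in the lattice
`L` of integer kernel vectors of a totally unimodular matrix: circuits are supports of vectors with
entries 0, 1, -1, and the odd supports ("words") are closed under symmetric difference.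

Take circuits `C₁`, `C₂` violating (b) with minimal union E, and let w be `C₁ ∆ C₂`. Minimality and
binary arithmetic force w to be a disjoint union of two circuits, every other nonempty word in E to
be a circuit, and every word in E to lie in w or contain `C₁ ∩ C₂`
(`IsMinimalBadPair.isExceptionalWord`).

Then signs enter. `L` contains the half of each of its vectors with even entries, so sums of
signings can be halved. This gives a signing of w whose restriction to each proper word in w stays
in `L` (`Extends.conformal`). One more halving shows that two proper words in w never have a proper
symmetric difference (`not_properWord_symmDiff`). Eliminating an element of `C₁ ∩ C₂` would produce
such a pair. -/

/-- A lattice `L` of integer vectors together with a family of circuits which it realises: every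
circuit is the support of a `{0, 1, -1}`-valued vector of `L`, and the odd support of every vector
of `L` is empty or contains a circuit. -/
structure IsCircuitLattice {α : Type*} (L : AddSubgroup (α → ℤ)) (Circ : Set α → Prop) : Prop where
  mem_of_two_nsmul : ∀ y : α → ℤ, 2 • y ∈ L → y ∈ L
  finite_support : ∀ y ∈ L, (Function.support y).Finite
  nonempty : ∀ C, Circ C → C.Nonempty
  eq_of_subset : ∀ C D, Circ C → Circ D → C ⊆ D → C = D
  exists_signing : ∀ C, Circ C →
    ∃ c ∈ L, (∀ i ∈ C, c i = 1 ∨ c i = -1) ∧ ∀ i ∉ C, c i = 0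
  exists_circuit : ∀ y ∈ L, {i | Odd (y i)}.Nonempty → ∃ C ⊆ {i | Odd (y i)}, Circ C

/-! ### Binary words of a circuit lattice. -/

namespace IsCircuitLattice

variable {α : Type*} {L : AddSubgroup (α → ℤ)} {Circ : Set α → Prop}

/-- The odd supports of the vectors of `L`. -/
def Word (L : AddSubgroup (α → ℤ)) (u : Set α) : Prop :=
  ∃ y ∈ L, ∀ i, i ∈ u ↔ Odd (y i)

/-- `y` is a vector of `L` with support `u` and entries `0`, `1` and `-1`. -/
def Signing (L : AddSubgroup (α → ℤ)) (y : α → ℤ) (u : Set α) : Prop :=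
  y ∈ L ∧ (∀ i ∈ u, y i = 1 ∨ y i = -1) ∧ ∀ i ∉ u, y i = 0

lemma Word.symmDiff {u v : Set α} (hu : Word L u) (hv : Word L v) : Word L (u ∆ v) := by
  obtain ⟨y, hy, hyu⟩ := hu
  obtain ⟨z, hz, hzv⟩ := hv
  refine ⟨y + z, L.add_mem hy hz, fun i => ?_⟩
  rw [Set.mem_symmDiff, hyu, hzv, Pi.add_apply, Int.odd_add']
  by_cases h1 : Odd (y i) <;> by_cases h2 : Odd (z i) <;> simp [h1, h2, ← Int.not_odd_iff_even]

lemma Signing.word {y : α → ℤ} {u : Set α} (h : Signing L y u) : Word L u := by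
  refine ⟨y, h.1, fun i => ?_⟩
  by_cases hi : i ∈ u
  · rcases h.2.1 i hi with h1 | h1 <;> simp [hi, h1]
  · simp [hi, h.2.2 i hi]

lemma Signing.neg {y : α → ℤ} {u : Set α} (h : Signing L y u) : Signing L (-y) u := by
  refine ⟨L.neg_mem h.1, fun i hi => ?_, fun i hi => ?_⟩
  · rcases h.2.1 i hi with h1 | h1 <;> simp [h1]
  · simp [h.2.2 i hi]

section

variable (S : IsCircuitLattice L Circ)

include S

lemma word {C : Set α} (hC : Circ C) : Word L C := by
  obtain ⟨c, hc⟩ := S.exists_signing C hC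
  exact Signing.word (y := c) hc

lemma finite {u : Set α} (hu : Word L u) : u.Finite := by
  obtain ⟨y, hy, hyu⟩ := hu
  refine (S.finite_support y hy).subset fun i hi => ?_
  have := (hyu i).1 hi
  rw [Function.mem_support]
  rintro h
  simp [h] at this

lemma exists_circuit_subset {u : Set α} (hu : Word L u) (hne : u.Nonempty) :
    ∃ C ⊆ u, Circ C := by
  obtain ⟨y, hy, hyu⟩ := hu
  have : {i | Odd (y i)} = u := by ext i; exact (hyu i).symm
  simpa [this] using S.exists_circuit y hy (by rwa [this])

lemma eq_of_word_subset {u C : Set α} (hu : Word L u) (hne : u.Nonempty) (hC : Circ C)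
    (h : u ⊆ C) : u = C := by
  obtain ⟨D, hDu, hD⟩ := S.exists_circuit_subset hu hne
  have := S.eq_of_subset D C hD hC (hDu.trans h)
  exact h.antisymm (this ▸ hDu)

/-- Remove from the word a circuit that misses `e`; what remains is a smaller word still containing
`e`. -/
lemma exists_circuit_mem {u : Set α} (hu : Word L u) {e : α} (he : e ∈ u) :
    ∃ C ⊆ u, Circ C ∧ e ∈ C := by
  induction hn : u.ncard using Nat.strong_induction_on generalizing u with
  | _ n ih =>
    obtain ⟨C, hCu, hC⟩ := S.exists_circuit_subset hu ⟨e, he⟩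
    by_cases heC : e ∈ C
    · exact ⟨C, hCu, hC, heC⟩
    have hsub : u ∆ C ⊆ u := by
      intro i hi
      rw [Set.mem_symmDiff] at hi
      rcases hi with hi | hi
      · exact hi.1
      · exact hCu hi.1
    obtain ⟨f, hf⟩ := S.nonempty C hC
    have hlt : (u ∆ C).ncard < u.ncard := by
      refine Set.ncard_lt_ncard ⟨hsub, fun h => ?_⟩ (S.finite hu)
      have := h (hCu hf)
      rw [Set.mem_symmDiff] at this
      have := hCu hf
      tauto
    obtain ⟨D, hDu, hD⟩ := ih _ (hn ▸ hlt) (hu.symmDiff (S.word hC))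
      (by rw [Set.mem_symmDiff]; tauto) rfl
    exact ⟨D, hDu.trans hsub, hD⟩

end

end IsCircuitLattice

/-! ### Binary structure of a minimal bad pair. -/

namespace IsCircuitLattice

variable {α : Type*} {L : AddSubgroup (α → ℤ)} {Circ : Set α → Prop}

/-- Circuits `C₁` and `C₂` which witness that the circuit-difference property fails while it holds
for all circuits whose union is a proper subset of `C₁ ∪ C₂`. -/
structure IsMinimalBadPair (Circ : Set α → Prop) (C₁ C₂ : Set α) : Prop where
  left : Circ C₁
  right : Circ C₂
  ne : C₁ ≠ C₂
  inter : (C₁ ∩ C₂).Nonempty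
  not_circuit : ¬ Circ (C₁ ∆ C₂)
  symmDiff : ∀ C D, Circ C → Circ D → C ⊆ C₁ ∪ C₂ → D ⊆ C₁ ∪ C₂ → C ≠ D → (∃ y ∈ C, y ∈ D) →
    (∃ z ∈ C₁ ∪ C₂, z ∉ C ∧ z ∉ D) → Circ (C ∆ D)

lemma IsMinimalBadPair.swap {C₁ C₂ : Set α} (h : IsMinimalBadPair Circ C₁ C₂) :
    IsMinimalBadPair Circ C₂ C₁ where
  left := h.right
  right := h.left
  ne := h.ne.symm
  inter := by rw [Set.inter_comm]; exact h.inter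
  not_circuit := by rw [symmDiff_comm]; exact h.not_circuit
  symmDiff := by rw [Set.union_comm]; exact h.symmDiff

lemma exists_isMinimalBadPair (S : IsCircuitLattice L Circ) {C₁ C₂ : Set α} (h₁ : Circ C₁)
    (h₂ : Circ C₂) (hne : C₁ ≠ C₂) (hi : (C₁ ∩ C₂).Nonempty) (hn : ¬ Circ (C₁ ∆ C₂)) :
    ∃ D₁ D₂, IsMinimalBadPair Circ D₁ D₂ := by
  induction hk : (C₁ ∪ C₂).ncard using Nat.strong_induction_on generalizing C₁ C₂ with
  | _ k ih =>
    by_contra hcon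
    refine hcon ⟨C₁, C₂, h₁, h₂, hne, hi, hn, ?_⟩
    rintro C D hC hD hCs hDs hCD ⟨y, hyC, hyD⟩ ⟨z, hz, hzC, hzD⟩
    by_contra hnc
    refine hcon (ih _ ?_ hC hD hCD ⟨y, hyC, hyD⟩ hnc rfl)
    rw [← hk]
    refine Set.ncard_lt_ncard ⟨Set.union_subset hCs hDs, fun h => ?_⟩
      ((S.finite (S.word h₁)).union (S.finite (S.word h₂)))
    rcases h hz with h | h
    exacts [hzC h, hzD h]

variable {C₁ C₂ : Set α} (S : IsCircuitLattice L Circ) (B : IsMinimalBadPair Circ C₁ C₂)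

include S B

/-- Otherwise `u` would lie in `C₂`, hence equal `C₂`, which contains points of `C₁ ∩ C₂`. -/
lemma exists_mem_left {u : Set α} (hu : Word L u) (hne : u.Nonempty) (h : u ⊆ C₁ ∆ C₂) :
    ∃ i ∈ u, i ∈ C₁ ∧ i ∉ C₂ := by
  by_contra! hcon
  have hsub : u ⊆ C₂ := fun i hi => by
    have := h hi
    rw [Set.mem_symmDiff] at this
    have := hcon i hi
    tauto
  obtain ⟨x, hx⟩ := B.inter
  have := S.eq_of_word_subset hu hne B.right hsub
  have h3 := h (this ▸ hx.2 : x ∈ u)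
  rw [Set.mem_symmDiff] at h3
  have h4 := hx.1
  have h5 := hx.2
  tauto

lemma exists_mem_right {u : Set α} (hu : Word L u) (hne : u.Nonempty) (h : u ⊆ C₁ ∆ C₂) :
    ∃ i ∈ u, i ∈ C₂ ∧ i ∉ C₁ :=
  S.exists_mem_left B.swap hu hne (by rwa [symmDiff_comm])

/-- The symmetric difference of a minimal bad pair is the union of two disjoint circuits. -/
lemma exists_disjoint_circuits : ∃ D₁ D₂, Circ D₁ ∧ Circ D₂ ∧ Disjoint D₁ D₂ ∧
    D₁ ∪ D₂ = C₁ ∆ C₂ := by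
  have hne : (C₁ ∆ C₂).Nonempty := by
    rw [Set.nonempty_iff_ne_empty, ← Set.bot_eq_empty, Ne, symmDiff_eq_bot]
    exact B.ne
  have hw := (S.word B.left).symmDiff (S.word B.right)
  obtain ⟨D₁, hD₁w, hD₁⟩ := S.exists_circuit_subset hw hne
  have hu := hw.symmDiff (S.word hD₁)
  have hune : ((C₁ ∆ C₂) ∆ D₁).Nonempty := by
    rw [Set.nonempty_iff_ne_empty, ← Set.bot_eq_empty, Ne, symmDiff_eq_bot]
    rintro h
    exact B.not_circuit (h ▸ hD₁)
  obtain ⟨D₂, hD₂u, hD₂⟩ := S.exists_circuit_subset hu hune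
  by_cases hR : ((C₁ ∆ C₂) ∆ D₁) ∆ D₂ = ∅
  · rw [← Set.bot_eq_empty, symmDiff_eq_bot] at hR
    refine ⟨D₁, D₂, hD₁, hD₂, ?_, ?_⟩
    · rw [Set.disjoint_left]
      intro i h1 h2
      grind
    · ext i
      have := @hD₁w i
      simp only [← hR, Set.mem_union, Set.mem_symmDiff] at *
      tauto
  exfalso
  rw [← Ne, ← Set.nonempty_iff_ne_empty] at hR
  -- If a remainder is left, it has a point `r` outside `C₁`, `D₁` and `D₂`. Minimality applies to
  -- all circuits avoiding `r`, and ends by making `D₁ ∆ D₂` a circuit, although it properly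
  -- contains `D₁`.
  obtain ⟨r, hr, hrC₂, hrC₁⟩ := S.exists_mem_right B (hu.symmDiff (S.word hD₂)) hR
    (by grind)
  have hr' : r ∉ D₁ ∧ r ∉ D₂ := by grind
  obtain ⟨x, hx₁, hx₂⟩ := B.inter
  have hxD : x ∉ D₁ ∧ x ∉ D₂ := by grind
  have hdisj : ∀ i ∈ D₁, i ∉ D₂ := by grind
  have hD₂w : D₂ ⊆ C₁ ∆ C₂ := by grind
  obtain ⟨a, ha, haC, -⟩ := S.exists_mem_left B (S.word hD₁) (S.nonempty _ hD₁) hD₁w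
  obtain ⟨b, hb, hbC, -⟩ := S.exists_mem_left B (S.word hD₂) (S.nonempty _ hD₂) hD₂w
  have h1 : Circ (C₁ ∆ D₁) := by
    refine B.symmDiff _ _ B.left hD₁ Set.subset_union_left ?_ ?_ ⟨a, haC, ha⟩ ⟨r, ?_⟩
    · grind
    · grind
    · grind
  have h2 : Circ ((C₁ ∆ D₁) ∆ D₂) := by
    refine B.symmDiff _ _ h1 hD₂ ?_ ?_ ?_ ⟨b, ?_⟩ ⟨r, ?_⟩ <;> grind
  have h3 : Circ (C₁ ∆ ((C₁ ∆ D₁) ∆ D₂)) := by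
    refine B.symmDiff _ _ B.left h2 ?_ ?_ ?_ ⟨x, ?_⟩ ⟨r, ?_⟩ <;> grind
  have h4 : C₁ ∆ ((C₁ ∆ D₁) ∆ D₂) = D₁ ∆ D₂ := by
    rw [symmDiff_assoc, symmDiff_symmDiff_cancel_left]
  rw [h4] at h3
  have := S.eq_of_subset D₁ _ hD₁ h3 (by grind)
  grind

variable {D₁ D₂ : Set α} (hD₁ : Circ D₁) (hD₂ : Circ D₂) (hd : Disjoint D₁ D₂)
  (hD : D₁ ∪ D₂ = C₁ ∆ C₂)

include hD₁ hD₂ hd hD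

/-- Adding `D₁` and `D₂` to `Z` gives circuits avoiding a point of `C₁ ∩ C₂`. If `Z` left `C₁ ∆ C₂`,
the last of them would still meet `Z`, and their difference `C₁ ∆ C₂` would be a circuit. -/
lemma subset_symmDiff_of_not_inter_subset {Z : Set α} (hZ : Circ Z) (hZs : Z ⊆ C₁ ∪ C₂)
    (hX : ¬ C₁ ∩ C₂ ⊆ Z) (h₁ : (Z ∩ D₁).Nonempty) (h₂ : (Z ∩ D₂).Nonempty) : Z ⊆ C₁ ∆ C₂ := by
  obtain ⟨x, hx, hxZ⟩ := Set.not_subset.1 hX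
  obtain ⟨a, ha, ha₁⟩ := h₁
  obtain ⟨b, hb, hb₂⟩ := h₂
  have hw : ∀ i, i ∈ C₁ ∆ C₂ ↔ i ∈ D₁ ∨ i ∈ D₂ := fun i => by rw [← hD]; rfl
  have hd' := hd
  rw [Set.disjoint_left] at hd
  have h1 : Circ (Z ∆ D₁) := by
    refine B.symmDiff _ _ hZ hD₁ hZs ?_ ?_ ⟨a, ha, ha₁⟩ ⟨x, ?_⟩ <;> grind
  have h2 : Circ ((Z ∆ D₁) ∆ D₂) := by
    refine B.symmDiff _ _ h1 hD₂ ?_ ?_ ?_ ⟨b, ?_⟩ ⟨x, ?_⟩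
    · grind
    · grind
    · rintro h
      have h3 : D₁ ⊆ Z := by
        intro i hi
        have := hd hi
        rw [← h, Set.mem_symmDiff] at this
        tauto
      have := S.eq_of_subset _ _ hD₁ hZ h3
      grind
    · grind
    · grind
  by_contra hsub
  obtain ⟨y, hy, hyw⟩ := Set.not_subset.1 hsub
  rw [Set.mem_symmDiff] at hyw
  have h3 : Circ (Z ∆ ((Z ∆ D₁) ∆ D₂)) := by
    refine B.symmDiff _ _ hZ h2 ?_ ?_ ?_ ⟨y, ?_⟩ ⟨x, ?_⟩
    · grind
    · grind
    · rintro h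
      have : a ∉ Z := by
        have := hd ha₁
        rw [h, Set.mem_symmDiff, Set.mem_symmDiff]
        tauto
      exact this ha
    · grind
    · grind
  rw [symmDiff_assoc, symmDiff_symmDiff_cancel_left, hd'.symmDiff_eq_sup] at h3
  exact B.not_circuit (hD ▸ h3)

/-- A disagreement on `D₁` would make the circuit `Z ∆ C₁` meet both `D₁` and `D₂` while missing a
point of `C₁ ∩ C₂`; it would then lie in `C₁ ∆ C₂`, but it contains `x`. -/
lemma mem_iff_mem_left {Z : Set α} (hZ : Circ Z) (hZs : Z ⊆ C₁ ∪ C₂) (hX : ¬ C₁ ∩ C₂ ⊆ Z)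
    (hy : (Z ∩ (C₁ ∩ C₂)).Nonempty) (h₂ : ∀ i ∈ Z, i ∉ D₂) : ∀ i ∈ D₁, i ∈ Z ↔ i ∈ C₁ := by
  obtain ⟨x, hx, hxZ⟩ := Set.not_subset.1 hX
  obtain ⟨y, hyZ, hyX⟩ := hy
  obtain ⟨b, hb, hbC₁, hbC₂⟩ := S.exists_mem_left B (S.word hD₂) (S.nonempty _ hD₂)
    (hD ▸ Set.subset_union_right)
  obtain ⟨z, hz, hzC₂, hzC₁⟩ := S.exists_mem_right B (S.word hD₂) (S.nonempty _ hD₂)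
    (hD ▸ Set.subset_union_right)
  have h1 : Circ (Z ∆ C₁) := by
    refine B.symmDiff _ _ hZ B.left hZs ?_ ?_ ⟨y, ?_⟩ ⟨z, ?_⟩ <;> grind
  intro i hi
  by_contra hcon
  have := S.subset_symmDiff_of_not_inter_subset B hD₁ hD₂ hd hD h1 (by grind) (fun h => ?_) ⟨i, by grind, hi⟩
    ⟨b, by grind, hb⟩
  · have := @this x (by grind)
    grind
  · have := h hyX
    grind

/-- The elements of `C₁ ∩ C₂` are in series. If `Z` missed `D₂`, it would agree on `D₁` with both
`C₁` and `C₂`, yet each point of `D₁` lies in exactly one of them. So `Z` meets both halves, and the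
containment in `C₁ ∆ C₂` is absurd. -/
lemma inter_subset_of_circuit {Z : Set α} (hZ : Circ Z) (hZs : Z ⊆ C₁ ∪ C₂)
    (hy : (Z ∩ (C₁ ∩ C₂)).Nonempty) : C₁ ∩ C₂ ⊆ Z := by
  have key : ∀ D₁ D₂, Circ D₁ → Circ D₂ → Disjoint D₁ D₂ → D₁ ∪ D₂ = C₁ ∆ C₂ →
      ¬ C₁ ∩ C₂ ⊆ Z → ¬ ∀ i ∈ Z, i ∉ D₂ := by
    intro D₁ D₂ hD₁ hD₂ hd hD hX h₂
    have h1 := S.mem_iff_mem_left B hD₁ hD₂ hd hD hZ hZs hX hy h₂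
    have h2 := S.mem_iff_mem_left B.swap hD₁ hD₂ hd (by rw [hD, symmDiff_comm]) hZ
      (by rwa [Set.union_comm]) (by rwa [Set.inter_comm]) (by rwa [Set.inter_comm C₂]) h₂
    obtain ⟨i, hi⟩ := S.nonempty _ hD₁
    have h3 : i ∈ C₁ ∆ C₂ := hD ▸ Or.inl hi
    have := h1 i hi
    have := h2 i hi
    grind
  by_contra hX
  have h1 := key D₁ D₂ hD₁ hD₂ hd hD hX
  have h2 := key D₂ D₁ hD₂ hD₁ hd.symm (by rw [Set.union_comm, hD]) hX
  push Not at h1 h2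
  obtain ⟨y, hyZ, hy⟩ := hy
  have := S.subset_symmDiff_of_not_inter_subset B hD₁ hD₂ hd hD hZ hZs hX h2 h1 hyZ
  grind

lemma subset_or_inter_subset {u : Set α} (hu : Word L u) (hus : u ⊆ C₁ ∪ C₂) :
    u ⊆ C₁ ∆ C₂ ∨ C₁ ∩ C₂ ⊆ u := by
  by_contra! hcon
  obtain ⟨y, hyu, hy⟩ := Set.not_subset.1 hcon.1
  obtain ⟨Z, hZu, hZ, hyZ⟩ := S.exists_circuit_mem hu hyu
  exact hcon.2 ((S.inter_subset_of_circuit B hD₁ hD₂ hd hD hZ (hZu.trans hus)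
    ⟨y, hyZ, by grind⟩).trans hZu)

/-- All circuits here miss `x`, so minimality applies throughout. A point of `D₁` left uncovered
would make `Z₁ ∆ Z₂` a circuit, although it properly contains `Z₁`. -/
lemma union_eq_of_disjoint {Z₁ Z₂ : Set α} (h₁ : Circ Z₁) (h₂ : Circ Z₂) (hs₁ : Z₁ ⊆ C₁ ∆ C₂)
    (hs₂ : Z₂ ⊆ C₁ ∆ C₂) (hdisj : Disjoint Z₁ Z₂) : Z₁ ∪ Z₂ = C₁ ∆ C₂ := by
  obtain ⟨x, hx⟩ := B.inter
  have hw : ∀ i, i ∈ C₁ ∆ C₂ ↔ i ∈ D₁ ∨ i ∈ D₂ := fun i => by rw [← hD]; rfl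
  rw [Set.disjoint_left] at hdisj
  have key : ∀ D₁ D₂, Circ D₁ → Circ D₂ → Disjoint D₁ D₂ → D₁ ∪ D₂ = C₁ ∆ C₂ →
      D₁ ⊆ Z₁ ∪ Z₂ := by
    intro D₁ D₂ hD₁ hD₂ hd hD
    rw [Set.disjoint_left] at hd
    have hw : ∀ i, i ∈ C₁ ∆ C₂ ↔ i ∈ D₁ ∨ i ∈ D₂ := fun i => by rw [← hD]; rfl
    by_cases e₁ : Z₁ = D₁
    · exact e₁ ▸ Set.subset_union_left
    by_cases e₂ : Z₂ = D₁
    · exact e₂ ▸ Set.subset_union_right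
    have hm : ∀ Z, Circ Z → Z ⊆ C₁ ∆ C₂ → Z ≠ D₁ → Z ≠ D₂ → ∃ i ∈ D₁, i ∈ Z := by
      intro Z hZ hZs hne₁ hne₂
      by_contra! hcon
      exact hne₂ (S.eq_of_subset _ _ hZ hD₂ (by grind))
    by_cases f₁ : Z₁ = D₂
    · have := S.eq_of_subset Z₂ D₁ h₂ hD₁ (by grind)
      exact absurd this e₂
    by_cases f₂ : Z₂ = D₂
    · have := S.eq_of_subset Z₁ D₁ h₁ hD₁ (by grind)
      exact absurd this e₁
    obtain ⟨a, ha, haZ⟩ := hm Z₁ h₁ hs₁ e₁ f₁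
    obtain ⟨b, hb, hbZ⟩ := hm Z₂ h₂ hs₂ e₂ f₂
    have k1 : Circ (D₁ ∆ Z₁) := by
      refine B.symmDiff _ _ hD₁ h₁ ?_ ?_ ?_ ⟨a, ?_⟩ ⟨x, ?_⟩ <;> grind
    have k2 : Circ ((D₁ ∆ Z₁) ∆ Z₂) := by
      refine B.symmDiff _ _ k1 h₂ ?_ ?_ ?_ ⟨b, ?_⟩ ⟨x, ?_⟩
      · grind
      · grind
      · rintro h
        refine e₁ (S.eq_of_subset _ _ h₁ hD₁ fun i hi => ?_)
        by_contra hi'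
        exact hdisj hi (h ▸ (by grind))
      all_goals grind
    by_contra hcon
    obtain ⟨y, hy, hyZ⟩ := Set.not_subset.1 hcon
    have k3 : Circ (D₁ ∆ ((D₁ ∆ Z₁) ∆ Z₂)) := by
      refine B.symmDiff _ _ hD₁ k2 ?_ ?_ ?_ ⟨y, ?_⟩ ⟨x, ?_⟩
      · grind
      · grind
      · rintro h
        have : a ∈ (D₁ ∆ Z₁) ∆ Z₂ := h ▸ ha
        grind
      all_goals grind
    rw [symmDiff_assoc, symmDiff_symmDiff_cancel_left] at k3
    have := S.eq_of_subset _ _ h₁ k3 (by grind)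
    have : b ∈ Z₁ ∆ Z₂ := by grind
    grind
  have k1 := key D₁ D₂ hD₁ hD₂ hd hD
  have k2 := key D₂ D₁ hD₂ hD₁ hd.symm (by rw [Set.union_comm, hD])
  ext i
  have := hw i
  grind

/-- All but one of the nonempty words in the union of a minimal bad pair are circuits. -/
lemma circuit_of_word_subset {u : Set α} (hu : Word L u) (hus : u ⊆ C₁ ∪ C₂) (hne : u.Nonempty)
    (huw : u ≠ C₁ ∆ C₂) : Circ u := by
  obtain ⟨x, hx⟩ := B.inter
  have hw := (S.word B.left).symmDiff (S.word B.right)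
  have key : ∀ v, Word L v → v.Nonempty → v ⊆ C₁ ∆ C₂ → v ≠ C₁ ∆ C₂ → Circ v := by
    intro v hv hvne hvs hvw
    obtain ⟨Z₁, hZ₁v, hZ₁⟩ := S.exists_circuit_subset hv hvne
    by_cases he : v ∆ Z₁ = ∅
    · rw [← Set.bot_eq_empty, symmDiff_eq_bot] at he
      exact he ▸ hZ₁
    rw [← Ne, ← Set.nonempty_iff_ne_empty] at he
    obtain ⟨Z₂, hZ₂v, hZ₂⟩ := S.exists_circuit_subset (hv.symmDiff (S.word hZ₁)) he
    have := S.union_eq_of_disjoint B hD₁ hD₂ hd hD hZ₁ hZ₂ (hZ₁v.trans hvs) (by grind)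
      (Set.disjoint_left.2 (by grind))
    exact absurd (hvs.antisymm (this ▸ (by grind))) hvw
  rcases S.subset_or_inter_subset B hD₁ hD₂ hd hD hu hus with h | h
  · exact key u hu hne h huw
  -- A word containing `C₁ ∩ C₂` is `C₁ ∆ v` with `v` inside `C₁ ∆ C₂`, which reduces to the case
  -- already treated.
  have hv := (S.word B.left).symmDiff hu
  have hvs : C₁ ∆ u ⊆ C₁ ∆ C₂ := by
    intro i hi
    have := @h i
    have := @hus i
    grind
  have huv : u = C₁ ∆ (C₁ ∆ u) := by rw [symmDiff_symmDiff_cancel_left]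
  generalize C₁ ∆ u = v at hv hvs huv
  by_cases hve : v = ∅
  · rw [huv, hve, ← Set.bot_eq_empty, symmDiff_bot]
    exact B.left
  by_cases hvw : v = C₁ ∆ C₂
  · rw [huv, hvw, symmDiff_symmDiff_cancel_left]
    exact B.right
  rw [← Ne, ← Set.nonempty_iff_ne_empty] at hve
  have hvc := key v hv hve hvs hvw
  obtain ⟨a, ha, haC, -⟩ := S.exists_mem_left B hv hve hvs
  have hcv : ((C₁ ∆ C₂) ∆ v).Nonempty := by
    rw [Set.nonempty_iff_ne_empty, ← Set.bot_eq_empty, Ne, symmDiff_eq_bot]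
    exact fun h => hvw h.symm
  obtain ⟨b, hb, hbC, hbC'⟩ := S.exists_mem_right B (hw.symmDiff hv) hcv (by grind)
  rw [huv]
  refine B.symmDiff _ _ B.left hvc ?_ ?_ ?_ ⟨a, haC, ha⟩ ⟨b, ?_⟩ <;> grind

end IsCircuitLattice

/-! ### Signings of an exceptional word. -/

namespace IsCircuitLattice

variable {α : Type*} {L : AddSubgroup (α → ℤ)} {Circ : Set α → Prop}

/-- All nonempty words contained in `E` are circuits, except for `w`, and the elements of `E` outside
`w` are in series. -/
structure IsExceptionalWord (L : AddSubgroup (α → ℤ)) (Circ : Set α → Prop) (E w : Set α) :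
    Prop where
  word : Word L w
  subset : w ⊆ E
  sdiff_nonempty : (E \ w).Nonempty
  circuit : ∀ u, Word L u → u ⊆ E → u.Nonempty → u ≠ w → Circ u
  subset_or : ∀ u, Word L u → u ⊆ E → u ⊆ w ∨ E \ w ⊆ u

/-- A word of `E` which contains all elements outside `w`. -/
structure Transversal (L : AddSubgroup (α → ℤ)) (E w C : Set α) : Prop where
  word : Word L C
  subset : C ⊆ E
  sdiff_subset : E \ w ⊆ C

/-- A proper nonempty word contained in `w`. -/
structure ProperWord (L : AddSubgroup (α → ℤ)) (w u : Set α) : Prop where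
  word : Word L u
  subset : u ⊆ w
  nonempty : u.Nonempty
  ne : u ≠ w

/-- The signing `s` of `w` agrees on `C ∩ w` with a signing of `C`. -/
def Extends (L : AddSubgroup (α → ℤ)) (w : Set α) (s : α → ℤ) (C : Set α) : Prop :=
  Signing L s w ∧ ∃ c, Signing L c C ∧ ∀ i ∈ C, i ∈ w → c i = s i

lemma Extends.neg {w C : Set α} {s : α → ℤ} (h : Extends L w s C) : Extends L w (-s) C := by
  obtain ⟨hs, c, hc, hcs⟩ := h
  exact ⟨hs.neg, -c, hc.neg, fun i hi hiw => by simp [hcs i hi hiw]⟩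

lemma Signing.of_two_nsmul (S : IsCircuitLattice L Circ) {y : α → ℤ} {u : Set α}
    (h : 2 • y ∈ L) (h₁ : ∀ i ∈ u, y i = 1 ∨ y i = -1) (h₀ : ∀ i ∉ u, y i = 0) :
    Signing L y u :=
  ⟨S.mem_of_two_nsmul y h, h₁, h₀⟩

open Classical in
-- It is half the sum of the two signings.
lemma Signing.agreement (S : IsCircuitLattice L Circ) {s t : α → ℤ} {w : Set α}
    (hs : Signing L s w) (ht : Signing L t w) :
    Signing L (fun i => if s i = t i then s i else 0) {i | i ∈ w ∧ s i = t i} := by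
  refine Signing.of_two_nsmul S ?_ ?_ ?_
  · convert L.add_mem hs.1 ht.1 using 1
    ext i
    by_cases hi : i ∈ w
    · have := hs.2.1 i hi
      have := ht.2.1 i hi
      simp only [Pi.smul_apply, Pi.add_apply, nsmul_eq_mul]
      split_ifs <;> push_cast <;> lia
    · simp [hs.2.2 i hi, ht.2.2 i hi]
  · rintro i ⟨hi, hst⟩
    simpa [hst] using ht.2.1 i hi
  · intro i hi
    by_cases hiw : i ∈ w
    · have : ¬ s i = t i := fun h => hi ⟨hiw, h⟩
      simp [this]
    · simp [hs.2.2 i hiw]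

/-- The agreement set is a word inside the circuit `C`, so it is empty or all of `C`. -/
lemma Signing.eq_or_eq_neg (S : IsCircuitLattice L Circ) {s t : α → ℤ} {C : Set α} (hC : Circ C)
    (hs : Signing L s C) (ht : Signing L t C) : t = s ∨ t = -s := by
  have ha := (Signing.agreement S hs ht).word
  by_cases hne : {i | i ∈ C ∧ s i = t i}.Nonempty
  · left
    have := S.eq_of_word_subset ha hne hC fun i hi => hi.1
    ext i
    by_cases hi : i ∈ C
    · rw [← this] at hi
      exact hi.2.symm
    · rw [hs.2.2 i hi, ht.2.2 i hi]
  · right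
    ext i
    by_cases hi : i ∈ C
    · have h1 : s i ≠ t i := fun h => hne ⟨i, hi, h⟩
      have := hs.2.1 i hi
      have := ht.2.1 i hi
      rw [Pi.neg_apply]
      lia
    · simp [hs.2.2 i hi, ht.2.2 i hi]

variable {E w C u : Set α}

lemma Transversal.symmDiff (hC : Transversal L E w C) (hwE : w ⊆ E) (hu : Word L u) (huw : u ⊆ w) :
    Transversal L E w (C ∆ u) := by
  refine ⟨hC.word.symmDiff hu, ?_, ?_⟩
  · have := hC.subset
    grind
  · have := hC.sdiff_subset
    grind

variable (S : IsCircuitLattice L Circ) (H : IsExceptionalWord L Circ E w)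

include H in
lemma Transversal.circuit (hC : Transversal L E w C) : Circ C := by
  obtain ⟨x, hx⟩ := H.sdiff_nonempty
  exact H.circuit C hC.word hC.subset ⟨x, hC.sdiff_subset hx⟩
    fun h => hx.2 (h ▸ hC.sdiff_subset hx)

include H in
lemma ProperWord.circuit (hu : ProperWord L w u) : Circ u :=
  H.circuit u hu.word (hu.subset.trans H.subset) hu.nonempty hu.ne

include H in
lemma ProperWord.compl (hu : ProperWord L w u) : ProperWord L w (w ∆ u) where
  word := H.word.symmDiff hu.word
  subset := by have := hu.subset; grind
  nonempty := by
    rw [Set.nonempty_iff_ne_empty, ← Set.bot_eq_empty, Ne, symmDiff_eq_bot]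
    exact hu.ne.symm
  ne := by
    obtain ⟨i, hi⟩ := hu.nonempty
    have := hu.subset hi
    rintro h
    grind

lemma Signing.add_compl {y z : α → ℤ} (huw : u ⊆ w) (hy : Signing L y u)
    (hz : Signing L z (w ∆ u)) : Signing L (y + z) w := by
  refine ⟨L.add_mem hy.1 hz.1, fun i hi => ?_, fun i hi => ?_⟩
  · by_cases hiu : i ∈ u
    · rw [Pi.add_apply, hz.2.2 i (by grind), add_zero]
      exact hy.2.1 i hiu
    · rw [Pi.add_apply, hy.2.2 i hiu, zero_add]
      exact hz.2.1 i (by grind)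
  · rw [Pi.add_apply, hy.2.2 i (by grind), hz.2.2 i (by grind), add_zero]

include H in
lemma exists_extends (hu : ProperWord L w u) (hC : Transversal L E w C)
    (S : IsCircuitLattice L Circ) : ∃ s, Extends L w s C := by
  obtain ⟨y, hy⟩ := S.exists_signing u (hu.circuit H)
  obtain ⟨z, hz⟩ := S.exists_signing _ ((hu.compl H).circuit H)
  have ht := Signing.add_compl (L := L) hu.subset hy hz
  generalize y + z = t at ht
  have hC' := hC.symmDiff H.subset H.word subset_rfl
  obtain ⟨x, hx⟩ := H.sdiff_nonempty
  obtain ⟨c, hc⟩ : ∃ c, Signing L c C := S.exists_signing C (hC.circuit H)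
  obtain ⟨d, hd, hdx⟩ : ∃ d, Signing L d (C ∆ w) ∧ d x = c x := by
    obtain ⟨d, hd⟩ : ∃ d, Signing L d (C ∆ w) := S.exists_signing _ (hC'.circuit H)
    have h1 := hd.2.1 x (hC'.sdiff_subset hx)
    have h2 := hc.2.1 x (hC.sdiff_subset hx)
    by_cases h : d x = c x
    · exact ⟨d, hd, h⟩
    · exact ⟨-d, hd.neg, by rw [Pi.neg_apply]; lia⟩
  have hsw : ∀ i ∈ w, (i ∈ C ∧ d i = 0) ∨ (c i = 0 ∧ (d i = 1 ∨ d i = -1)) := by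
    intro i hi
    by_cases hiC : i ∈ C
    · exact .inl ⟨hiC, hd.2.2 i (by grind)⟩
    · exact .inr ⟨hc.2.2 i hiC, hd.2.1 i (by grind)⟩
  have hEC := hC.subset
  have hEC' := hC'.subset
  have hsX : ∀ i ∈ E \ w, (c i = 1 ∨ c i = -1) ∧ (d i = 1 ∨ d i = -1) ∧ t i = 0 := fun i hi =>
    ⟨hc.2.1 i (hC.sdiff_subset hi), hd.2.1 i (hC'.sdiff_subset hi), ht.2.2 i hi.2⟩
  have hs0 : ∀ i ∉ E, c i = 0 ∧ d i = 0 ∧ t i = 0 := fun i hi =>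
    ⟨hc.2.2 i fun h => hi (hEC h), hd.2.2 i fun h => hi (hEC' h),
      ht.2.2 i fun h => hi (H.subset h)⟩
  -- Every entry is even: on `w` exactly one of `c`, `d` is nonzero, and so is `t`; on `E \ w` both
  -- `c` and `d` are odd and `t` vanishes.
  have hval : ∀ i, ∃ k, c i - d i + t i = 2 * k ∧ (k = 0 ∨ k = 1 ∨ k = -1) := by
    intro i
    by_cases hiw : i ∈ w
    · have h1 := hsw i hiw
      have h2 := ht.2.1 i hiw
      have h3 := hc.2.1 i
      exact ⟨(c i - d i + t i) / 2, by grind, by grind⟩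
    · by_cases hiE : i ∈ E
      · obtain ⟨h1, h2, h3⟩ := hsX i ⟨hiE, hiw⟩
        exact ⟨(c i - d i + t i) / 2, by lia, by lia⟩
      · obtain ⟨h1, h2, h3⟩ := hs0 i hiE
        exact ⟨0, by lia, by lia⟩
  choose k hk hk1 using hval
  have hksig : Signing L k {i | k i ≠ 0} := by
    refine Signing.of_two_nsmul S ?_ (fun i hi => ?_) fun i hi => ?_
    · convert L.add_mem (L.sub_mem hc.1 hd.1) ht.1 using 1
      ext i
      simp [hk]
    · exact (hk1 i).resolve_left hi
    · simpa using hi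
  -- The half `k` vanishes at `x`, so the series property puts its support in `w`. Hence `c` and `d`
  -- agree on `E \ w`, and `c - d` is the desired signing.
  have hsub := H.subset_or _ hksig.word fun i hi => by
    by_contra hiE
    obtain ⟨h1, h2, h3⟩ := hs0 i hiE
    have := hk i
    exact hi (by lia)
  have hx0 : k x = 0 := by
    have := hk x
    have := (hsX x hx).2.2
    lia
  have hsub' := hsub.resolve_right fun h => h hx hx0
  have hX : ∀ i ∈ E \ w, c i - d i = 0 := by
    intro i hi
    have h1 : k i = 0 := by
      by_contra h
      exact hi.2 (hsub' h)
    have := hk i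
    have := (hsX i hi).2.2
    lia
  refine ⟨c - d, ⟨L.sub_mem hc.1 hd.1, fun i hi => ?_, fun i hi => ?_⟩, c, hc, ?_⟩
  · have := hc.2.1 i
    have := hsw i hi
    rw [Pi.sub_apply]
    grind
  · rw [Pi.sub_apply]
    by_cases hiE : i ∈ E
    · exact hX i ⟨hiE, hi⟩
    · have := hs0 i hiE
      lia
  · intro i hi hiw
    rw [Pi.sub_apply, hd.2.2 i (by grind), sub_zero]

lemma Extends.sub_signing {c s : α → ℤ} (hc : Signing L c C) (hs : Signing L s w)
    (h : ∀ i ∈ C, i ∈ w → c i = s i) : Signing L (c - s) (C ∆ w) := by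
  refine ⟨L.sub_mem hc.1 hs.1, fun i hi => ?_, fun i hi => ?_⟩
  · rw [Pi.sub_apply]
    rcases hi with ⟨h1, h2⟩ | ⟨h1, h2⟩
    · rw [hs.2.2 i h2, sub_zero]
      exact hc.2.1 i h1
    · rw [hc.2.2 i h2]
      have := hs.2.1 i h1
      lia
  · rw [Pi.sub_apply]
    by_cases h1 : i ∈ C
    · rw [h i h1 (by grind), sub_self]
    · rw [hc.2.2 i h1, hs.2.2 i (by grind), sub_self]

include S H in
-- Both `c - s` and `c - t` sign the circuit `C ∆ w`, and they agree at a point outside `w`, which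
-- fixes the sign.
lemma Extends.eq_of_signing {c s t : α → ℤ} (hC : Transversal L E w C) (hc : Signing L c C)
    (hs : Signing L s w) (ht : Signing L t w) (hcs : ∀ i ∈ C, i ∈ w → c i = s i)
    (hct : ∀ i ∈ C, i ∈ w → c i = t i) : t = s := by
  have hC' := hC.symmDiff H.subset H.word subset_rfl
  obtain ⟨x, hx⟩ := H.sdiff_nonempty
  rcases Signing.eq_or_eq_neg S (hC'.circuit H) (Extends.sub_signing hc hs hcs)
    (Extends.sub_signing hc ht hct) with h | h
  · exact sub_right_injective h
  · have h1 := congrFun h x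
    have h2 := hc.2.1 x (hC.sdiff_subset hx)
    simp only [Pi.neg_apply, Pi.sub_apply, hs.2.2 x hx.2, ht.2.2 x hx.2] at h1
    lia

include S H in
lemma Extends.eq_or_eq_neg {s t : α → ℤ} (hC : Transversal L E w C) (hs : Extends L w s C)
    (ht : Extends L w t C) : t = s ∨ t = -s := by
  obtain ⟨hs, c, hc, hcs⟩ := hs
  obtain ⟨ht, d, hd, hdt⟩ := ht
  rcases Signing.eq_or_eq_neg S (hC.circuit H) hc hd with rfl | rfl
  · exact .inl (Extends.eq_of_signing S H hC hd hs ht hcs hdt)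
  · right
    have := Extends.eq_of_signing S H hC hc hs ht.neg hcs fun i hi hiw => by
      have := hdt i hi hiw
      rw [Pi.neg_apply] at *
      lia
    rw [← this, neg_neg]

include S in
lemma Extends.symmDiff_agreement {s t : α → ℤ} (hs : Extends L w s C) (ht : Signing L t w) :
    Extends L w t (C ∆ {i | i ∈ w ∧ s i = t i}) := by
  classical
  obtain ⟨hs, c, hc, hcs⟩ := hs
  have ha := Signing.agreement S hs ht
  -- The witness is the agreement vector minus `c`: on `C` within `w` the common signs cancel, and
  -- where `s` and `t` differ, `-c` equals `t`.
  refine ⟨ht, _, ⟨L.sub_mem ha.1 hc.1, fun i hi => ?_, fun i hi => ?_⟩, fun i hi hiw => ?_⟩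
  all_goals
    have h1 := hs.2.1 i
    have h2 := ht.2.1 i
    have h3 := hs.2.2 i
    have h5 := hc.2.1 i
    have h6 := hc.2.2 i
    have h7 := hcs i
    simp only [Set.mem_symmDiff, Set.mem_ofPred_eq] at hi
    simp only [Pi.sub_apply]
    by_cases hw : i ∈ w <;> by_cases hC : i ∈ C <;> by_cases hst : s i = t i <;>
      simp_all <;> lia

include S H in
lemma not_extends_symmDiff {p : α → ℤ} (hC : Transversal L E w C) (hu : ProperWord L w u)
    (h₁ : Extends L w p C) (h₂ : Extends L w p (C ∆ u)) : False := by
  obtain ⟨y, hy⟩ : ∃ y, Signing L y u := S.exists_signing u (hu.circuit H)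
  obtain ⟨z, hz⟩ : ∃ z, Signing L z (w ∆ u) := S.exists_signing _ ((hu.compl H).circuit H)
  -- The signings `y + z` and `y - z` agree exactly on `u`. Both would extend to the same
  -- transversal, hence be equal up to sign, but they agree on `u` and differ on its complement.
  have hs := hy.add_compl hu.subset hz
  have ht := hy.add_compl hu.subset hz.neg
  have ha := (Signing.agreement S h₁.1 hs).word
  have k1 := h₁.symmDiff_agreement S hs
  have k2 := h₂.symmDiff_agreement S hs
  have k3 := k1.symmDiff_agreement S ht
  have hst : {i | i ∈ w ∧ (y + z) i = (y + -z) i} = u := by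
    ext i
    simp only [Set.mem_ofPred_eq, Pi.add_apply, Pi.neg_apply]
    constructor
    · rintro ⟨hiw, h⟩
      by_contra hiu
      have := hz.2.1 i (by grind)
      lia
    · intro hi
      refine ⟨hu.subset hi, ?_⟩
      rw [hz.2.2 i (fun h => by have := hu.subset hi; grind)]
      lia
  rw [hst, symmDiff_right_comm] at k3
  have hT := (hC.symmDiff H.subset hu.word hu.subset).symmDiff H.subset ha fun i hi => hi.1
  obtain ⟨i, hi⟩ := hu.nonempty
  obtain ⟨j, hj⟩ := (hu.compl H).nonempty
  rcases Extends.eq_or_eq_neg S H hT k2 k3 with h | h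
  · have h1 := congrFun h j
    have := hz.2.1 j hj
    simp only [Pi.add_apply, Pi.neg_apply] at h1
    lia
  · have h1 := congrFun h i
    have := hy.2.1 i hi
    simp only [Pi.add_apply, Pi.neg_apply] at h1
    lia

include S H in
open Classical in
/-- A signing of `w` which extends to `C` is conformal to the signings of all words in `w`. -/
lemma Extends.conformal {p : α → ℤ} (hC : Transversal L E w C) (hu : ProperWord L w u)
    (hp : Extends L w p C) : Signing L (fun i => if i ∈ u then p i else 0) u := by
  have hT := hC.symmDiff H.subset hu.word hu.subset
  obtain ⟨q, hq⟩ := exists_extends H hu hT S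
  have key : ∀ q, Extends L w q (C ∆ u) → {i | i ∈ w ∧ p i = q i} = u →
      Signing L (fun i => if i ∈ u then p i else 0) u := by
    intro q hq he
    have := Signing.agreement S hp.1 hq.1
    rw [he] at this
    convert this using 1
    ext i
    by_cases hiw : i ∈ w
    · have : i ∈ u ↔ p i = q i := by rw [← he]; simp [hiw]
      simp [this]
    · simp [hp.1.2.2 i hiw]
  set b := {i | i ∈ w ∧ p i = q i} with hb
  have hbw : b ⊆ w := fun i hi => hi.1
  have hbW : Word L b := (Signing.agreement S hp.1 hq.1).word
  by_cases hbu : b = u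
  · exact key q hq hbu
  by_cases hbw' : b ∆ u = w
  · refine key (-q) hq.neg ?_
    ext i
    have h1 := hp.1.2.1 i
    have h2 := hq.1.2.1 i
    have h3 : i ∈ b ∆ u ↔ i ∈ w := by rw [hbw']
    have h4 := @hu.subset i
    simp only [hb, Set.mem_symmDiff, Set.mem_ofPred_eq, Pi.neg_apply] at h3 ⊢
    by_cases hw : i ∈ w <;> by_cases hiu : i ∈ u <;> simp_all
    all_goals lia
  -- In the remaining case `q` extends to both `C ∆ b` and `C ∆ u`, which differ by the proper word
  -- `b ∆ u`.
  refine (not_extends_symmDiff S H (p := q) (C := C ∆ b) (u := b ∆ u)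
    (hC.symmDiff H.subset hbW hbw) ⟨hbW.symmDiff hu.word, ?_, ?_, hbw'⟩
    (hp.symmDiff_agreement S hq.1) ?_).elim
  · have := hu.subset
    grind
  · rw [Set.nonempty_iff_ne_empty, ← Set.bot_eq_empty, Ne, symmDiff_eq_bot]
    exact hbu
  · rwa [symmDiff_assoc, symmDiff_symmDiff_cancel_left]

include S H in
/-- Modulo an exceptional word there are no two independent words. -/
theorem not_properWord_symmDiff (hC : Transversal L E w C) {v : Set α} (hu : ProperWord L w u)
    (hv : ProperWord L w v) : ¬ ProperWord L w (u ∆ v) := by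
  classical
  intro huv
  obtain ⟨p, hp⟩ := exists_extends H hu hC S
  have h1 := hp.conformal S H hC hu
  have h2 := hp.conformal S H hC hv
  have h3 := hp.conformal S H hC huv
  -- Restricting `p` to `u`, `v` and `u ∆ v`, the first two minus the third give twice the
  -- restriction to `u ∩ v`. This word lies in the circuit `u`, so it is empty or equal to `u`; both
  -- are impossible.
  have h4 : Signing L (fun i => if i ∈ u ∩ v then p i else 0) (u ∩ v) := by
    refine Signing.of_two_nsmul S ?_ ?_ ?_
    · convert L.sub_mem (L.add_mem h1.1 h2.1) h3.1 using 1
      ext i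
      by_cases hiu : i ∈ u <;> by_cases hiv : i ∈ v <;>
        simp [hiu, hiv, Set.mem_symmDiff, two_mul]
    · rintro i hi
      simpa [hi, hi.1, hi.2] using hp.1.2.1 i (hu.subset hi.1)
    · rintro i hi
      simp only [hi, if_false]
  by_cases hne : (u ∩ v).Nonempty
  · have e1 := S.eq_of_word_subset h4.word hne (hu.circuit H) Set.inter_subset_left
    have := S.eq_of_subset u v (hu.circuit H) (hv.circuit H) (e1 ▸ Set.inter_subset_right)
    obtain ⟨i, hi⟩ := huv.nonempty
    grind
  · have e1 := S.eq_of_subset u _ (hu.circuit H) (huv.circuit H) fun i hi => by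
      have : i ∉ v := fun h => hne ⟨i, hi, h⟩
      grind
    obtain ⟨i, hi⟩ := hv.nonempty
    have : i ∉ u := fun h => hne ⟨i, h, hi⟩
    grind

end IsCircuitLattice

/-! ### From strong elimination to circuit-difference. -/

namespace IsCircuitLattice

variable {α : Type*} {L : AddSubgroup (α → ℤ)} {Circ : Set α → Prop}

lemma IsMinimalBadPair.isExceptionalWord {C₁ C₂ : Set α} (S : IsCircuitLattice L Circ)
    (B : IsMinimalBadPair Circ C₁ C₂) : IsExceptionalWord L Circ (C₁ ∪ C₂) (C₁ ∆ C₂) := by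
  obtain ⟨D₁, D₂, hD₁, hD₂, hd, hD⟩ := S.exists_disjoint_circuits B
  have hX : (C₁ ∪ C₂) \ (C₁ ∆ C₂) = C₁ ∩ C₂ := by
    ext i
    simp only [Set.mem_sdiff, Set.mem_union, Set.mem_symmDiff, Set.mem_inter_iff]
    tauto
  exact ⟨(S.word B.left).symmDiff (S.word B.right), by grind, hX ▸ B.inter,
    fun u hu hus hne hw => S.circuit_of_word_subset B hD₁ hD₂ hd hD hu hus hne hw,
    fun u hu hus => hX ▸ S.subset_or_inter_subset B hD₁ hD₂ hd hD hu hus⟩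

/-- In a circuit lattice, the symmetric strong elimination property for circuits implies the
circuit-difference property. -/
theorem circuit_symmDiff (S : IsCircuitLattice L Circ)
    (hE : ∀ C₁ C₂ : Set α, Circ C₁ → Circ C₂ → ∀ e₁ e₂ e : α, e₁ ∈ C₁ \ C₂ → e₂ ∈ C₂ \ C₁ →
      e ∈ C₁ ∩ C₂ → ∃ C₃ : Set α, Circ C₃ ∧ {e₁, e₂} ⊆ C₃ ∧ C₃ ⊆ (C₁ ∪ C₂) \ {e})
    {C D : Set α} (hC : Circ C) (hD : Circ D) (hne : C ≠ D) (hi : (C ∩ D).Nonempty) :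
    Circ (C ∆ D) := by
  by_contra hn
  obtain ⟨C₁, C₂, B⟩ := S.exists_isMinimalBadPair hC hD hne hi hn
  obtain ⟨D₁, D₂, hD₁, hD₂, hd, hD⟩ := S.exists_disjoint_circuits B
  have H := B.isExceptionalWord S
  have hs₁ : D₁ ⊆ C₁ ∆ C₂ := hD ▸ Set.subset_union_left
  have hs₂ : D₂ ⊆ C₁ ∆ C₂ := hD ▸ Set.subset_union_right
  obtain ⟨a, ha, ha₁, ha₂⟩ := S.exists_mem_left B (S.word hD₁) (S.nonempty _ hD₁) hs₁
  obtain ⟨b, hb, hb₂, hb₁⟩ := S.exists_mem_right B (S.word hD₂) (S.nonempty _ hD₂) hs₂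
  obtain ⟨x, hx⟩ := B.inter
  obtain ⟨Z, hZ, habZ, hZs⟩ := hE C₁ C₂ B.left B.right a b x ⟨ha₁, ha₂⟩ ⟨hb₂, hb₁⟩ hx
  have haZ : a ∈ Z := habZ (by simp)
  have hbZ : b ∈ Z := habZ (by simp)
  have hxZ : x ∉ Z := fun h => (hZs h).2 rfl
  have hZw := S.subset_symmDiff_of_not_inter_subset B hD₁ hD₂ hd hD hZ (fun i hi => (hZs hi).1)
    (fun h => hxZ (h hx)) ⟨a, haZ, ha⟩ ⟨b, hbZ, hb⟩
  rw [Set.disjoint_left] at hd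
  have hbD : b ∉ D₁ := fun h => hd h hb
  have hZD : ¬ D₁ ⊆ Z := fun h => hbD (S.eq_of_subset _ _ hD₁ hZ h ▸ hbZ)
  have hw : ∀ C, Circ C → C ≠ C₁ ∆ C₂ := fun C hC h => B.not_circuit (h ▸ hC)
  have hT : Transversal L (C₁ ∪ C₂) (C₁ ∆ C₂) C₁ := ⟨S.word B.left, by grind, by grind⟩
  -- `D₁` and `Z` are proper as circuits, and `D₁ ∆ Z` is proper because it contains `b` and misses
  -- `a`.
  refine not_properWord_symmDiff S H hT ⟨S.word hD₁, hs₁, S.nonempty _ hD₁, hw _ hD₁⟩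
    ⟨S.word hZ, hZw, S.nonempty _ hZ, hw _ hZ⟩
    ⟨(S.word hD₁).symmDiff (S.word hZ), by grind, ⟨b, by grind⟩, fun h => ?_⟩
  have : a ∈ D₁ ∆ Z := h ▸ hs₁ ha
  grind

end IsCircuitLattice

/-! ### Kernels of totally unimodular matrices. -/

/-- A real matrix with linearly independent columns has a nonsingular square submatrix which uses
all columns. -/
lemma Matrix.exists_submatrix_det_ne_zero {m n : Type*} [Finite m] [Fintype n] [DecidableEq n]
    (A : Matrix m n ℝ) (hA : LinearIndependent ℝ A.col) :
    ∃ f : n → m, (A.submatrix f id).det ≠ 0 := by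
  have := Fintype.ofFinite m
  have hspan : Submodule.span ℝ (Set.range A.row) = ⊤ := by
    apply Submodule.eq_top_of_finrank_eq
    rw [← Matrix.rank_eq_finrank_span_row, Module.finrank_fintype_fun_eq_card]
    have := hA.rank_matrix
    simpa using this
  obtain ⟨κ, a, -, hsp, hli⟩ := exists_linearIndependent' ℝ A.row
  rw [hspan] at hsp
  let b := Module.Basis.mk hli hsp.ge
  let e : n ≃ κ := (Pi.basisFun ℝ n).indexEquiv b
  refine ⟨a ∘ e, ?_⟩
  have h2 : LinearIndependent ℝ (A.submatrix (a ∘ e) id).row := hli.comp e e.injective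
  rw [Matrix.linearIndependent_rows_iff_isUnit, Matrix.isUnit_iff_isUnit_det] at h2
  exact h2.ne_zero

lemma Matrix.IsTotallyUnimodular.det_mem {m n k R : Type*} [CommRing R] [Fintype k] [DecidableEq k]
    {A : Matrix m n R} (hA : A.IsTotallyUnimodular) (f : k → m) (g : k → n) :
    (A.submatrix f g).det ∈ Set.range SignType.cast :=
  (A.isTotallyUnimodular_iff_fintype.1 hA) k f g

lemma SignType.cast_range_cases {R : Type*} [Ring R] {x : R}
    (h : x ∈ Set.range (SignType.cast : SignType → R)) : x = 0 ∨ x = 1 ∨ x = -1 := by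
  obtain ⟨s, rfl⟩ := h
  cases s <;> simp

/-- Minimally dependent columns of a totally unimodular matrix satisfy a linear relation with
coefficients `1` and `-1`. -/
lemma Matrix.IsTotallyUnimodular.exists_sign_mulVec_eq_zero {m n : Type*} [Finite m] [Fintype n]
    {A : Matrix m n ℝ} (hA : A.IsTotallyUnimodular) (hdep : ¬ LinearIndependent ℝ A.col)
    (hmin : ∀ e, LinearIndependent ℝ (fun j : {j // j ≠ e} => A.col j.1)) :
    ∃ c : n → ℤ, (∀ j, c j = 1 ∨ c j = -1) ∧ A *ᵥ (fun j => (c j : ℝ)) = 0 := by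
  classical
  rw [Fintype.linearIndependent_iff] at hdep
  push Not at hdep
  obtain ⟨y, hy, e, hye⟩ := hdep
  have hrow : ∀ i, ∑ j, y j * A i j = 0 := fun i => by
    simpa [Finset.sum_apply] using congrFun hy i
  have hy0 : ∀ j, y j ≠ 0 := by
    intro k hk
    have h1 := Fintype.linearIndependent_iff.1 (hmin k) (fun j => y j) (by
      ext i
      have := hrow i
      rw [Fintype.sum_eq_add_sum_subtype_ne _ k] at this
      simpa [Finset.sum_apply, hk] using this)
    have : e ≠ k := fun h => hye (h ▸ hk)
    exact hye (h1 ⟨e, this⟩)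
  obtain ⟨f, hf⟩ := Matrix.exists_submatrix_det_ne_zero
    (A.submatrix id (Subtype.val : {j // j ≠ e} → n)) (hmin e)
  rw [Matrix.submatrix_submatrix] at hf
  set B := A.submatrix (id ∘ f) (Subtype.val ∘ id : {j // j ≠ e} → n) with hB
  have hBdet := (SignType.cast_range_cases (hA.det_mem (id ∘ f)
    (Subtype.val ∘ id : {j // j ≠ e} → n))).resolve_left hf
  have hBy : B *ᵥ (fun j => y j) = -(y e • fun i => A (f i) e) := by
    ext i
    have := hrow (f i)
    rw [Fintype.sum_eq_add_sum_subtype_ne _ e, add_comm] at this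
    simp only [Matrix.mulVec, dotProduct, hB, Matrix.submatrix_apply, Function.comp, id,
      Pi.neg_apply, Pi.smul_apply, smul_eq_mul]
    rw [eq_neg_iff_add_eq_zero, ← this]
    congr 1
    exact Finset.sum_congr rfl fun j _ => mul_comm _ _
  -- Cramer's rule; the replaced matrix is again a submatrix of `A`, so all determinants are 0, 1 or
  -- -1 and the entries of `y` have equal absolute value.
  have hcr : ∀ j : {j // j ≠ e}, B.det * y j = -(y e * (B.updateCol j fun i => A (f i) e).det) := by
    intro j
    have h1 := congrFun (B.cramer_eq_adjugate_mulVec (B *ᵥ (fun j => y j))) j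
    rw [Matrix.mulVec_mulVec, Matrix.adjugate_mul, Matrix.smul_mulVec, Matrix.one_mulVec, hBy,
      map_neg, map_smul] at h1
    simpa [Matrix.cramer_apply] using h1.symm
  have hup : ∀ j : {j // j ≠ e}, (B.updateCol j fun i => A (f i) e) =
      A.submatrix f (fun k => if k = j then e else k) := by
    intro j
    ext i k
    by_cases hk : k = j
    · simp [hk]
    · simp [hk, hB]
  have hratio : ∀ j, y j = y e ∨ y j = - y e := by
    intro j
    by_cases hj : j = e
    · exact .inl (hj ▸ rfl)
    have h1 := hcr ⟨j, hj⟩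
    rw [hup] at h1
    have h2 := hy0 j
    rcases SignType.cast_range_cases (hA.det_mem f
      (fun k : {j // j ≠ e} => if k = ⟨j, hj⟩ then e else (k : n))) with h3 | h3 | h3 <;>
      rw [h3] at h1 <;> rcases hBdet with h4 | h4 <;> rw [h4] at h1
    · exact absurd (by simpa using h1) h2
    · exact absurd (by simpa using h1) h2
    all_goals first
      | (left; linarith)
      | (right; linarith)
  refine ⟨fun j => if y j = y e then 1 else -1, fun j => by dsimp only; split_ifs <;> simp, ?_⟩
  have : (fun j => (((if y j = y e then 1 else -1 : ℤ)) : ℝ)) = (y e)⁻¹ • y := by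
    ext j
    rw [Pi.smul_apply, smul_eq_mul, inv_mul_eq_div, eq_div_iff hye]
    by_cases h : y j = y e
    · simp [h]
    · simp only [h, if_false]
      push_cast
      linarith [(hratio j).resolve_left h]
  rw [this, Matrix.mulVec_smul]
  have : A *ᵥ y = 0 := by
    ext i
    simpa [Matrix.mulVec, dotProduct, mul_comm] using hrow i
  rw [this, smul_zero]

/-- The columns of a totally unimodular matrix at which an integral vector of its kernel is odd are
linearly dependent. -/
lemma Matrix.IsTotallyUnimodular.not_linearIndepOn_odd {m n : Type*} [Finite m] [Fintype n]
    {A : Matrix m n ℝ} (hA : A.IsTotallyUnimodular) {y : n → ℤ}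
    (hy : A *ᵥ (fun j => (y j : ℝ)) = 0) (hne : ∃ j, Odd (y j)) :
    ¬ LinearIndepOn ℝ A.col {j | Odd (y j)} := by
  classical
  intro hli
  have hint : ∀ i j, ∃ a : ℤ, (a : ℝ) = A i j := by
    intro i j
    rcases SignType.cast_range_cases (hA.apply i j) with h | h | h
    exacts [⟨0, by simp [h]⟩, ⟨1, by simp [h]⟩, ⟨-1, by simp [h]⟩]
  choose a ha using hint
  obtain ⟨f, hf⟩ := Matrix.exists_submatrix_det_ne_zero
    (A.submatrix id (Subtype.val : {j | Odd (y j)} → n)) hli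
  rw [Matrix.submatrix_submatrix] at hf
  have hdet := (SignType.cast_range_cases (hA.det_mem _ _)).resolve_left hf
  set B : Matrix {j | Odd (y j)} {j | Odd (y j)} ℤ := Matrix.of fun i j => a (f i) j with hB
  have hBA : A.submatrix (id ∘ f) (Subtype.val ∘ id) = B.map (Int.castRingHom ℝ) := by
    ext i j
    simp [hB, ha]
  have hcast : B.det = 1 ∨ B.det = -1 := by
    rw [hBA, ← RingHom.mapMatrix_apply, ← RingHom.map_det] at hdet
    simp only [eq_intCast] at hdet
    exact_mod_cast hdet
  -- Determinant 1 or -1 survives reduction mod 2, whereas the relation `y` becomes the all-ones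
  -- vector in the kernel of `B`.
  have h2 : (B.map (Int.castRingHom (ZMod 2))).det ≠ 0 := by
    rw [← RingHom.mapMatrix_apply, ← RingHom.map_det]
    rcases hcast with h | h <;> simp [h]
  refine h2 (Matrix.exists_mulVec_eq_zero_iff.1 ⟨fun _ => 1, ?_, ?_⟩)
  · obtain ⟨j, hj⟩ := hne
    exact fun h => one_ne_zero (congrFun h ⟨j, hj⟩)
  · ext i
    have h3 : ∑ j, a (f i) j * y j = 0 := by
      have := congrFun hy (f i)
      simp only [Matrix.mulVec, dotProduct, ← ha, Pi.zero_apply] at this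
      exact_mod_cast this
    have h4 := congrArg (Int.cast : ℤ → ZMod 2) h3
    push_cast at h4
    rw [← Fintype.sum_subtype_add_sum_subtype (fun j => Odd (y j))] at h4
    have h5 : ∑ j : {j // ¬ Odd (y j)}, (a (f i) j : ZMod 2) * (y j : ZMod 2) = 0 := by
      refine Finset.sum_eq_zero fun j _ => ?_
      have : ((y j : ℤ) : ZMod 2) = 0 := (ZMod.intCast_eq_zero_iff_even).2
        (Int.not_odd_iff_even.1 j.2)
      rw [this, mul_zero]
    rw [h5, add_zero] at h4
    simp only [Matrix.mulVec, dotProduct, hB, Matrix.map_apply, Matrix.of_apply, mul_one,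
      Pi.zero_apply]
    refine Eq.trans (Finset.sum_congr rfl fun j _ => ?_) h4
    have : ((y j : ℤ) : ZMod 2) = 1 := (ZMod.intCast_eq_one_iff_odd).2 j.2
    simp [this]

/-! ### The circuit lattice of a regular matroid. -/

namespace Matroid

variable {α : Type*}

/-- The integral vectors supported on `M.E` which lie in the kernel of `A`. -/
def kernelLattice (M : Matroid α) {r : ℕ} [Fintype M.E] (A : Matrix (Fin r) M.E ℝ) :
    AddSubgroup (α → ℤ) where
  carrier := {y | (∀ i ∉ M.E, y i = 0) ∧ A *ᵥ (fun j => (y j : ℝ)) = 0}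
  zero_mem' := ⟨fun _ _ => rfl, by ext; simp [mulVec, dotProduct]⟩
  add_mem' := by
    rintro y z ⟨hy, hy'⟩ ⟨hz, hz'⟩
    refine ⟨fun i hi => by simp [hy i hi, hz i hi], ?_⟩
    have : (fun j : M.E => (((y + z) j : ℤ) : ℝ)) =
        (fun j : M.E => (y j : ℝ)) + fun j : M.E => (z j : ℝ) := by
      ext j; simp
    rw [this, mulVec_add, hy', hz', add_zero]
  neg_mem' := by
    rintro y ⟨hy, hy'⟩
    refine ⟨fun i hi => by simp [hy i hi], ?_⟩
    have : (fun j : M.E => (((-y) j : ℤ) : ℝ)) = -(fun j : M.E => (y j : ℝ)) := by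
      ext j; simp
    rw [this, mulVec_neg, hy', neg_zero]

lemma isCircuitLattice_kernelLattice (M : Matroid α) {r : ℕ} [Fintype M.E]
    {A : Matrix (Fin r) M.E ℝ} (hA : A.IsTotallyUnimodular)
    (hI : ∀ I : Set M.E, M.Indep (Subtype.val '' I) ↔ LinearIndepOn ℝ A.col I) :
    IsCircuitLattice (M.kernelLattice A) M.IsCircuit where
  mem_of_two_nsmul := by
    rintro y ⟨hy, hy'⟩
    refine ⟨fun i hi => by simpa using hy i hi, ?_⟩
    have : (fun j : M.E => (((2 • y) j : ℤ) : ℝ)) = (2 : ℝ) • (fun j : M.E => (y j : ℝ)) := by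
      ext j; simp
    rw [this, mulVec_smul] at hy'
    exact (smul_eq_zero.1 hy').resolve_left two_ne_zero
  finite_support := by
    rintro y ⟨hy, -⟩
    refine (Set.toFinite M.E).subset fun i hi => ?_
    by_contra h
    exact hi (hy i h)
  nonempty := fun C hC => hC.nonempty
  eq_of_subset := fun C D hC hD h => hC.eq_of_subset_isCircuit hD h
  exists_signing := by
    classical
    intro C hC
    have hCE := hC.subset_ground
    have himg : Subtype.val '' ((↑) ⁻¹' C : Set M.E) = C := by
      rw [Subtype.image_preimage_coe, Set.inter_eq_right.2 hCE]
    set C' : Set M.E := (↑) ⁻¹' C with hC'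
    have hdep : ¬ LinearIndependent ℝ (A.submatrix id (Subtype.val : C' → M.E)).col := by
      intro h
      exact hC.not_indep (himg ▸ (hI C').2 h)
    have hmin : ∀ e : C', LinearIndependent ℝ
        (fun j : {j // j ≠ e} => (A.submatrix id (Subtype.val : C' → M.E)).col j.1) := by
      intro e
      have h1 : LinearIndepOn ℝ A.col (C' \ {e.1}) := by
        rw [← hI, Set.image_sdiff Subtype.val_injective, himg, Set.image_singleton]
        exact hC.sdiff_singleton_indep e.2
      exact h1.comp (fun j : {j // j ≠ e} => (⟨j.1.1, j.1.2, fun h => j.2 (Subtype.ext h)⟩ :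
        (C' \ {e.1} : Set M.E))) fun j k h => by
          simpa [Subtype.ext_iff] using h
    obtain ⟨c, hc, hc0⟩ :=
      (hA.submatrix id (Subtype.val : C' → M.E)).exists_sign_mulVec_eq_zero hdep hmin
    refine ⟨fun i => if h : ∃ hE : i ∈ M.E, i ∈ C then c ⟨⟨i, h.1⟩, h.2⟩ else 0,
      ⟨fun i hi => by simp [hi], ?_⟩, fun i hi => ?_, fun i hi => by simp [hi]⟩
    · ext i
      rw [← hc0]
      simp only [mulVec, dotProduct, submatrix_apply, id]
      rw [← Fintype.sum_subtype_add_sum_subtype (fun j : M.E => j ∈ C')]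
      have h2 : ∑ j : {j // ¬ j ∈ C'}, A i j * ((if h : ∃ hE : (j.1 : α) ∈ M.E, (j.1 : α) ∈ C then
          c ⟨⟨j.1, h.1⟩, h.2⟩ else 0 : ℤ) : ℝ) = 0 := by
        refine Finset.sum_eq_zero fun j _ => ?_
        have : (j.1 : α) ∉ C := j.2
        simp [this]
      rw [h2, add_zero]
      refine Finset.sum_congr rfl fun j _ => ?_
      have : (j.1 : α) ∈ C := j.2
      simp [this]
    · dsimp only
      rw [dif_pos (show ∃ _ : i ∈ M.E, i ∈ C from ⟨hCE hi, hi⟩)]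
      exact hc _
  exists_circuit := by
    rintro y ⟨hy, hy'⟩ ⟨i, hi⟩
    have hE : {i | Odd (y i)} ⊆ M.E := by
      intro i hi
      by_contra h
      simp [hy i h] at hi
    have h1 := hA.not_linearIndepOn_odd (y := fun j : M.E => y j) hy' ⟨⟨i, hE hi⟩, hi⟩
    have himg : Subtype.val '' {j : M.E | Odd (y j)} = {i | Odd (y i)} := by
      change Subtype.val '' ((↑) ⁻¹' {i | Odd (y i)} : Set M.E) = _
      rw [Subtype.image_preimage_coe, Set.inter_eq_right.2 hE]
    rw [← hI, himg] at h1
    exact Dep.exists_isCircuit_subset ⟨h1, hE⟩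

end Matroid

theorem corollary1p3 {α : Type*} (M : Matroid α) [M.Finite]
    (hconn : M.Connected) (hreg : M.IsRegular) :
    M.SymmetricStrongCircuitElimination ↔ M.CircuitDifference := by
  constructor
  · intro hE C D hC hD hne hi
    obtain ⟨r, A, hA, hI⟩ := hreg
    have : Fintype M.E := M.ground_finite.fintype
    exact (M.isCircuitLattice_kernelLattice hA hI).circuit_symmDiff hE hC hD hne hi
  · rintro hD C₁ C₂ h₁ h₂ e₁ e₂ e he₁ he₂ he
    refine ⟨symmDiff C₁ C₂, hD C₁ C₂ h₁ h₂ ?_ ⟨e, he⟩, ?_, ?_⟩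
    · rintro rfl
      exact he₁.2 he₁.1
    · rintro i (rfl | rfl)
      exacts [.inl he₁, .inr he₂]
    · rintro i (hi | hi)
      · exact ⟨.inl hi.1, fun h => hi.2 (h ▸ he.2)⟩
      · exact ⟨.inr hi.1, fun h => hi.2 (h ▸ he.1)⟩
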